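/- Let $k\ge 2$, $n\ge k$ and $m\ge 0$ be integers and let $0\le p\le 1$. The $p$-polarized random $k$-CNF $\Phi_m=\Phi_m(n,k,p)=C_1\wedge\dots\wedge C_m$ on Boolean variables $x_1,\dots,x_n$ is constructed as follows. For $1\le i\le m$ and $1\le j\le k$ take independent random objects $K_i$, $B_i$, $P_{ij}$, where $K_i=(v_{i1},\dots,v_{ik})$ is uniformly distributed over the $k$-tuples of distinct indices in $\{1,\dots,n\}$, $\Pr(B_i=1)=\Pr(B_i=-1)=\tfrac12$, and $\Pr(P_{ij}=1)=p$, $\Pr(P_{ij}=-1)=1-p$. Let $z_{ij}=x_{v_{ij}}$ if $B_iP_{ij}=1$ and $z_{ij}=\neg x_{v_{ij}}$ otherwise, and let $C_i=z_{i1}\vee\dots\vee z_{ik}$. Write $\Phi_m\in\mathrm{SAT}$ if some truth assignment satisfies all clauses of $\Phi_m$, and for $-\tfrac12\le b\le\tfrac12$ put $$P_m(b)=\Pr\bigl(\Phi_m(n,k,\tfrac12-b)\in\mathrm{SAT}\bigr).$$ **Proposition.** For every integer $k\ge 2$ there is a real constant $c=c(k)\ge k$ such that for all integers $n>c$ and $m\geq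 0$ with $m/n\in[\tfrac12,2^k]$ and all $b\in[0,\tfrac12]$, the function $P_m$ is differentiable at $b$ (from the left if $b=\tfrac12$) and $$P_m'(b)\le c\,n^{-\frac{k-1}{2k}}.$$ -/

import Mathlib

open MeasureTheory ProbabilityTheory

namespace PolarizedSAT

/-- Truth assignments to the Boolean variables `x_1, …, x_n`; the value `1` is TRUE and the value
`-1` is FALSE. -/
abbrev Assignment (n : ℕ) : Type := Fin n → ℤˣ

/-- A literal on one of `n` variables: `(v, 1)` is the pure literal `x_v` and `(v, -1)` is the
negated literal `¬ x_v`. -/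
abbrev Literal (n : ℕ) : Type := Fin n × ℤˣ

/-- The literal `z` is TRUE under the assignment `σ`. -/
def Literal.Holds {n : ℕ} (z : Literal n) (σ : Assignment n) : Prop := σ z.1 = z.2

/-- A `k`-clause `z_1 ∨ … ∨ z_k`, given by its literals. -/
abbrev Clause (n k : ℕ) : Type := Fin k → Literal n

/-- The assignment `σ` satisfies the clause `C`. -/
def Clause.Holds {n k : ℕ} (C : Clause n k) (σ : Assignment n) : Prop := ∃ j, (C j).Holds σ

/-- A `k`-CNF `C_1 ∧ … ∧ C_m`, given by its clauses. -/
abbrev Formula (n k m : ℕ) : Type := Fin m → Clause n k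

/-- The formula `F` belongs to `SAT`: some assignment satisfies all of its clauses. -/
def Formula.Satisfiable {n k m : ℕ} (F : Formula n k m) : Prop :=
  ∃ σ : Assignment n, ∀ i, (F i).Holds σ

/-- The random data `(K, B, (P_1, …, P_k))` behind one random clause: the tuple of indices of its
variables, the sign of the clause, and the signs of the individual positions. -/
abbrev ClauseData (n k : ℕ) : Type := (Fin k → Fin n) × ℤˣ × (Fin k → ℤˣ)

/-- The clause built from `(K, B, (P_1, …, P_k))`: its `j`-th literal is `x_{K_j}` if `B P_j = 1`
and `¬ x_{K_j}` otherwise. -/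
def ClauseData.toClause {n k : ℕ} (d : ClauseData n k) : Clause n k :=
  fun j => (d.1 j, d.2.1 * d.2.2 j)

/-- Every set of signs is measurable. -/
instance instDiscreteSign : DiscreteMeasurableSpace ℤˣ :=
  ⟨fun s => ⟨Units.val '' s, MeasurableSet.of_discrete,
    Set.preimage_image_eq s Units.val_injective⟩⟩

/-- For `0 ≤ p ≤ 1`, the law of a random sign that is `1` with probability `p` and `-1` with
probability `1 - p`. -/
noncomputable def signLaw (p : ℝ) : Measure ℤˣ :=
  ENNReal.ofReal p • Measure.dirac 1 + ENNReal.ofReal (1 - p) • Measure.dirac (-1)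

/-- The law of the data of one `p`-polarized random clause: `K` is uniform among the `k`-tuples of
distinct indices, `B` is a fair sign, each `P_j` is `1` with probability `p`, and all of these are
independent. -/
noncomputable def clauseLaw (n k : ℕ) (p : ℝ) : Measure (ClauseData n k) :=
  (uniformOn {K : Fin k → Fin n | Function.Injective K}).prod
    ((signLaw (1 / 2)).prod (Measure.pi fun _ : Fin k => signLaw p))

/-- The law of the data of `m` independent `p`-polarized random clauses. -/
noncomputable def formulaLaw (n k m : ℕ) (p : ℝ) : Measure (Fin m → ClauseData n k) :=
  Measure.pi fun _ : Fin m => clauseLaw n k p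

/-- `P_m(b)`, the probability that the random `k`-CNF with `m` clauses on `n` variables and with
polarization `p = 1/2 - b` is satisfiable. Meaningful for `-1/2 ≤ b ≤ 1/2`, that is, for
`0 ≤ p ≤ 1`. -/
noncomputable def satProb (n k m : ℕ) (b : ℝ) : ℝ :=
  (formulaLaw n k m (1 / 2 - b)).real
    {d | Formula.Satisfiable fun i : Fin m => (d i).toClause}

end PolarizedSAT

/-!
The derivative of the satisfiability probability `P_m` in `b` is a sum over the clauses of the
derivative of the probability that a fresh clause keeps the remaining formula `F` satisfiable. A
fresh clause destroys the satisfiability of `F` exactly when all its literals contradict frozen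
variables, that is, variables on which all satisfying assignments of `F` agree. If `F` has `x`
frozen variables, whose values add up to `S`, then up to normalization this has probability
`(x / 2 + b S) ^ k + (x / 2 - b S) ^ k`, with an error `O(x ^ (k - 1))` due to the tuples with
repeated indices. The main term is nondecreasing in `b ≥ 0` and at least `x ^ k / 2 ^ (k - 1)`.
The first property bounds the derivative by `O(m n ^ (-k)) E[x ^ (k - 1)]`, the second bounds
`E[x ^ k]` by `O(n ^ k) (P_m - P_{m + 1}) + O(n ^ (k - 1))`.

Both `P_m` and `P_{m + 1}` on `n + 1` variables are close to `P_m` on `n` variables. Indeed,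
deleting an unused variable, or a variable that occurs once together with its clause, does not
affect satisfiability, and what remains is a random formula with one variable (and one clause)
less. So the mean number of such variables, restricted to satisfiable formulas, is its overall
mean, of order `n`, times `P_m` on `n` variables. Replacing one clause changes the number of such
variables by at most `2 k`, so its standard deviation is `O(√m)`, and the Cauchy–Schwarz
inequality shows that the probabilities differ by `O(n ^ (-1 / 2))`. This makes
`E[x ^ k] = O(n ^ (k - 1 / 2))`, and splitting at `x = n ^ (1 - 1 / (2 k))` yields
`E[x ^ (k - 1)] = O(n ^ (k - 1 - (k - 1) / (2 k)))`.
-/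

namespace PolarizedSAT

section Expectation

variable {Ω Ω' : Type*} [Fintype Ω] [Fintype Ω'] {w : Ω → ℝ}

/-- The expectation of `f` when the points of the finite type `Ω` carry the weights `w`. The weights
form a probability distribution when `w ∈ stdSimplex ℝ Ω`. -/
noncomputable def expect (w f : Ω → ℝ) : ℝ := ∑ ω, w ω * f ω

lemma expect_add (w f g : Ω → ℝ) :
    expect w (fun ω => f ω + g ω) = expect w f + expect w g := by
  simp only [expect, mul_add, Finset.sum_add_distrib]

lemma expect_sub (w f g : Ω → ℝ) :
    expect w (fun ω => f ω - g ω) = expect w f - expect w g := by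
  simp only [expect, mul_sub, Finset.sum_sub_distrib]

lemma expect_const_mul (w : Ω → ℝ) (c : ℝ) (f : Ω → ℝ) :
    expect w (fun ω => c * f ω) = c * expect w f := by
  simp only [expect, Finset.mul_sum, mul_left_comm]

lemma expect_sum {ι : Type*} (s : Finset ι) (w : Ω → ℝ) (f : ι → Ω → ℝ) :
    expect w (fun ω => ∑ i ∈ s, f i ω) = ∑ i ∈ s, expect w (f i) := by
  simp only [expect, Finset.mul_sum]
  exact Finset.sum_comm

lemma expect_comm (w : Ω → ℝ) (w' : Ω' → ℝ) (f : Ω → Ω' → ℝ) :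
    expect w (fun ω => expect w' (f ω)) = expect w' fun ω' => expect w fun ω => f ω ω' := by
  simp only [expect, Finset.mul_sum, mul_left_comm]
  exact Finset.sum_comm

lemma expect_const (hw : ∑ ω, w ω = 1) (c : ℝ) : expect w (fun _ => c) = c := by
  rw [expect, ← Finset.sum_mul, hw, one_mul]

lemma expect_mono (hw : ∀ ω, 0 ≤ w ω) {f g : Ω → ℝ} (hfg : ∀ ω, f ω ≤ g ω) :
    expect w f ≤ expect w g :=
  Finset.sum_le_sum fun ω _ => mul_le_mul_of_nonneg_left (hfg ω) (hw ω)

lemma expect_nonneg (hw : ∀ ω, 0 ≤ w ω) {f : Ω → ℝ} (hf : ∀ ω, 0 ≤ f ω) : 0 ≤ expect w f :=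
  Finset.sum_nonneg fun ω _ => mul_nonneg (hw ω) (hf ω)

lemma abs_expect_sub_expect_le (hw : w ∈ stdSimplex ℝ Ω) {f g : Ω → ℝ} {D : ℝ}
    (hfg : ∀ ω, |f ω - g ω| ≤ D) : |expect w f - expect w g| ≤ D :=
  calc |expect w f - expect w g| = |∑ ω, w ω * (f ω - g ω)| := by
        rw [← expect_sub, expect]
    _ ≤ expect w fun ω => |f ω - g ω| := by
        refine (Finset.abs_sum_le_sum_abs _ _).trans_eq (Finset.sum_congr rfl fun ω _ => ?_)
        rw [abs_mul, abs_of_nonneg (hw.1 ω)]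
    _ ≤ D := (expect_mono hw.1 hfg).trans_eq (expect_const hw.2 D)

lemma expect_sub_const_sq (hw : ∑ ω, w ω = 1) (f : Ω → ℝ) (c : ℝ) :
    expect w (fun ω => (f ω - c) ^ 2) =
      expect w (fun ω => (f ω - expect w f) ^ 2) + (expect w f - c) ^ 2 := by
  have expand (a : ℝ) : expect w (fun ω => (f ω - a) ^ 2) =
      expect w (fun ω => f ω ^ 2) - 2 * a * expect w f + a ^ 2 := by
    rw [← expect_const_mul, ← expect_sub, ← expect_const hw (a ^ 2), ← expect_add]
    exact congrArg (expect w) (funext fun ω => by ring)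
  rw [expand, expand]
  ring

lemma sq_expect_mul_le (hw : ∀ ω, 0 ≤ w ω) (f g : Ω → ℝ) :
    expect w (fun ω => f ω * g ω) ^ 2 ≤
      expect w (fun ω => f ω ^ 2) * expect w fun ω => g ω ^ 2 :=
  Finset.sum_sq_le_sum_mul_sum_of_sq_le_mul _ (fun ω _ => mul_nonneg (hw ω) (sq_nonneg _))
    (fun ω _ => mul_nonneg (hw ω) (sq_nonneg _)) fun ω _ => by apply le_of_eq; ring

end Expectation

section IndependentSamples

variable {Γ Γ' : Type*} {m : ℕ}

/-- The joint weight of `m` independent samples, each drawn with the weights `w`. -/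
def iidWeight (w : Γ → ℝ) (F : Fin m → Γ) : ℝ := ∏ i, w (F i)

variable [Fintype Γ] [Fintype Γ'] {w : Γ → ℝ}

lemma iidWeight_mem_stdSimplex (hw : w ∈ stdSimplex ℝ Γ) :
    iidWeight w ∈ stdSimplex ℝ (Fin m → Γ) := by
  refine ⟨fun F => Finset.prod_nonneg fun i _ => hw.1 _, ?_⟩
  simp only [iidWeight, ← Fintype.sum_pow, hw.2, one_pow]

lemma expect_iidWeight_insertNth (w : Γ → ℝ) (i : Fin (m + 1)) (f : (Fin (m + 1) → Γ) → ℝ) :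
    expect (iidWeight w) f =
      expect w fun C => expect (iidWeight w) fun F : Fin m → Γ => f (i.insertNth C F) := by
  simp only [expect]
  rw [← (Fin.insertNthEquiv (fun _ => Γ) i).sum_comp, Fintype.sum_prod_type]
  refine Finset.sum_congr rfl fun C _ => ?_
  rw [Finset.mul_sum]
  refine Finset.sum_congr rfl fun F _ => ?_
  simp only [iidWeight, Fin.prod_univ_succAbove _ i, Fin.insertNthEquiv_apply,
    Fin.insertNth_apply_same, Fin.insertNth_apply_succAbove, mul_assoc]
  rfl

lemma expect_iidWeight_cons (w : Γ → ℝ) (f : (Fin (m + 1) → Γ) → ℝ) :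
    expect (iidWeight w) f =
      expect w fun C => expect (iidWeight w) fun F : Fin m → Γ => f (Fin.cons C F) := by
  simpa only [Fin.insertNth_zero'] using expect_iidWeight_insertNth w 0 f

lemma expect_iidWeight_zero (w : Γ → ℝ) (f : (Fin 0 → Γ) → ℝ) (F : Fin 0 → Γ) :
    expect (iidWeight w) f = f F := by
  rw [expect, Fintype.sum_unique, iidWeight, Fin.prod_univ_zero, one_mul, Subsingleton.elim F]

lemma expect_iidWeight_restrict {w : Γ → ℝ} {w' : Γ' → ℝ} {p : Γ → Prop} [DecidablePred p]
    {φ : Γ' → Γ} {a : ℝ}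
    (h : ∀ g : Γ → ℝ, expect w (fun C => if p C then g C else 0) = a * expect w' fun C => g (φ C))
    (f : (Fin m → Γ) → ℝ) :
    expect (iidWeight w) (fun F => if ∀ i, p (F i) then f F else 0) =
      a ^ m * expect (iidWeight w') fun F => f (φ ∘ F) := by
  induction m with
  | zero =>
    rw [expect_iidWeight_zero _ _ Fin.elim0, expect_iidWeight_zero _ _ Fin.elim0, pow_zero, one_mul,
      if_pos fun i => i.elim0]
    exact congrArg f (Subsingleton.elim _ _)
  | succ m ih =>
    have fix_first (C : Γ) : expect (iidWeight w) (fun F : Fin m → Γ =>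
        if ∀ i, p ((Fin.cons C F : Fin (m + 1) → Γ) i) then f (Fin.cons C F) else 0) =
          if p C then a ^ m * expect (iidWeight w') (fun F => f (Fin.cons C (φ ∘ F))) else 0 := by
      rw [← ih fun F => f (Fin.cons C F)]
      by_cases hC : p C <;> simp [Fin.forall_fin_succ, hC, expect]
    have comp_cons (C : Γ') (F : Fin m → Γ') :
        φ ∘ (Fin.cons C F : Fin (m + 1) → Γ') = Fin.cons (φ C) (φ ∘ F) :=
      funext <| Fin.cases rfl fun _ => rfl
    rw [expect_iidWeight_cons, expect_iidWeight_cons]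
    simp only [fix_first, h, comp_cons]
    rw [expect_const_mul, pow_succ', mul_assoc]

/-- Conditioning on the first sample splits off one fluctuation of size at most `D`. -/
lemma expect_sq_sub_expect_le (hw : w ∈ stdSimplex ℝ Γ) {Y : (Fin m → Γ) → ℝ} {D : ℝ}
    (hY : ∀ F i C, |Y (Function.update F i C) - Y F| ≤ D) :
    expect (iidWeight w) (fun F => (Y F - expect (iidWeight w) Y) ^ 2) ≤ m * D ^ 2 := by
  induction m with
  | zero => simp [expect_iidWeight_zero _ _ Fin.elim0]
  | succ m ih =>
    set μ := expect (iidWeight w) Y with hμ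
    let condMean (C : Γ) : ℝ := expect (iidWeight w) fun F : Fin m → Γ => Y (Fin.cons C F)
    have cond_var (C : Γ) : expect (iidWeight w)
        (fun F : Fin m → Γ => (Y (Fin.cons C F) - condMean C) ^ 2) ≤ m * D ^ 2 :=
      ih fun F i C' => by simpa only [Fin.cons_update] using hY (Fin.cons C F) i.succ C'
    have condMean_sub (C C' : Γ) : |condMean C' - condMean C| ≤ D :=
      abs_expect_sub_expect_le (iidWeight_mem_stdSimplex hw) fun F => by
        simpa only [Fin.update_cons_zero] using hY (Fin.cons C F) 0 C'
    have condMean_sub_mean (C : Γ) : (condMean C - μ) ^ 2 ≤ D ^ 2 := by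
      rw [← sq_abs, abs_sub_comm, hμ, expect_iidWeight_cons, ← expect_const hw.2 (condMean C)]
      exact pow_le_pow_left₀ (abs_nonneg _)
        (abs_expect_sub_expect_le hw fun C' => condMean_sub C C') 2
    calc expect (iidWeight w) (fun F => (Y F - μ) ^ 2)
        = expect w fun C => expect (iidWeight w)
            (fun F : Fin m → Γ => (Y (Fin.cons C F) - condMean C) ^ 2) + (condMean C - μ) ^ 2 := by
          rw [expect_iidWeight_cons]
          simp only [expect_sub_const_sq (iidWeight_mem_stdSimplex hw).2 _ μ, condMean]
      _ ≤ expect w fun _ => m * D ^ 2 + D ^ 2 :=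
          expect_mono hw.1 fun C => add_le_add (cond_var C) (condMean_sub_mean C)
      _ = (m + 1 : ℕ) * D ^ 2 := by
          rw [expect_const hw.2]
          push_cast
          ring

lemma abs_expect_mul_sub_le (hw : w ∈ stdSimplex ℝ Γ) {Y f : (Fin m → Γ) → ℝ} {D : ℝ}
    (hD : 0 ≤ D) (hY : ∀ F i C, |Y (Function.update F i C) - Y F| ≤ D)
    (hf : ∀ F, f F ∈ Set.Icc 0 1) :
    |expect (iidWeight w) (fun F => Y F * f F) - expect (iidWeight w) Y * expect (iidWeight w) f|
      ≤ D * √m := by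
  have hW := iidWeight_mem_stdSimplex (m := m) hw
  set μ := expect (iidWeight w) Y
  refine abs_le_of_sq_le_sq ?_ (by positivity)
  have f_sq : expect (iidWeight w) (fun F => f F ^ 2) ≤ 1 :=
    (expect_mono hW.1 fun F => pow_le_one₀ (hf F).1 (hf F).2).trans_eq (expect_const hW.2 1)
  calc (expect (iidWeight w) (fun F => Y F * f F) - μ * expect (iidWeight w) f) ^ 2
      = expect (iidWeight w) (fun F => (Y F - μ) * f F) ^ 2 := by
        simp only [sub_mul, expect_sub, expect_const_mul]
    _ ≤ expect (iidWeight w) (fun F => (Y F - μ) ^ 2) * expect (iidWeight w) (fun F => f F ^ 2) :=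
        sq_expect_mul_le hW.1 _ _
    _ ≤ m * D ^ 2 * 1 :=
        mul_le_mul (expect_sq_sub_expect_le hw hY) f_sq
          (expect_nonneg hW.1 fun F => sq_nonneg _) (by positivity)
    _ = (D * √m) ^ 2 := by rw [mul_pow, Real.sq_sqrt (Nat.cast_nonneg m)]; ring

lemma hasDerivAt_expect_iidWeight {W : ℝ → Γ → ℝ} {b : ℝ}
    (hW : ∀ C, DifferentiableAt ℝ (fun b => W b C) b) (f : (Fin (m + 1) → Γ) → ℝ) :
    HasDerivAt (fun b => expect (iidWeight (W b)) f)
      (∑ i : Fin (m + 1), expect (iidWeight (W b)) fun F : Fin m → Γ =>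
        deriv (fun b => expect (W b) fun C => f (i.insertNth C F)) b) b := by
  have deriv_expect (g : Γ → ℝ) : deriv (fun b => expect (W b) g) b =
      expect (fun C => deriv (fun b => W b C) b) g :=
    (HasDerivAt.fun_sum fun C _ => (hW C).hasDerivAt.mul_const _).deriv
  have leibniz : HasDerivAt (fun b => expect (iidWeight (W b)) f) (∑ F : Fin (m + 1) → Γ,
      (∑ i, (∏ j ∈ Finset.univ.erase i, W b (F j)) • deriv (fun b => W b (F i)) b) * f F) b :=
    HasDerivAt.fun_sum fun F _ =>
      (HasDerivAt.fun_finsetProd fun i _ => (hW (F i)).hasDerivAt).mul_const _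
  convert leibniz using 1
  simp only [Finset.sum_mul, deriv_expect]
  rw [Finset.sum_comm]
  refine Finset.sum_congr rfl fun i _ => ?_
  have univ_erase : Finset.univ.erase i = Finset.univ.image i.succAbove := by
    rw [Fin.image_succAbove_univ, Finset.compl_singleton]
  rw [← (Fin.insertNthEquiv (fun _ => Γ) i).sum_comp, Fintype.sum_prod_type_right, univ_erase,
    expect]
  refine Finset.sum_congr rfl fun F _ => ?_
  rw [expect, Finset.mul_sum]
  refine Finset.sum_congr rfl fun C _ => ?_
  rw [Finset.prod_image fun _ _ _ _ h => Fin.succAbove_right_injective h]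
  simp only [iidWeight, Fin.insertNthEquiv_apply, Fin.insertNth_apply_same,
    Fin.insertNth_apply_succAbove, smul_eq_mul, mul_assoc]
  rfl

end IndependentSamples

section RandomClause

variable {n k : ℕ} {b : ℝ}

/-- The probability of the clause data `d` under `clauseLaw n k (1 / 2 - b)`. As a polynomial in `b`
it is defined, with total mass `1`, for all real `b`. -/
noncomputable def clauseWeight (n k : ℕ) (b : ℝ) (d : ClauseData n k) : ℝ :=
  (if Function.Injective d.1 then (n.descFactorial k : ℝ)⁻¹ else 0) *
    (1 / 2 * ∏ j, (1 / 2 - ((d.2.2 j : ℤ) : ℝ) * b))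

lemma clauseWeight_nonneg (hb : |b| ≤ 1 / 2) (d : ClauseData n k) : 0 ≤ clauseWeight n k b d := by
  obtain ⟨hb₁, hb₂⟩ := abs_le.1 hb
  refine mul_nonneg (by split_ifs <;> positivity) (mul_nonneg (by norm_num)
    (Finset.prod_nonneg fun j _ => ?_))
  rcases Int.units_eq_one_or (d.2.2 j) with h | h <;> simp [h] <;> linarith

lemma differentiable_clauseWeight (d : ClauseData n k) :
    Differentiable ℝ fun b => clauseWeight n k b d := by
  unfold clauseWeight
  fun_prop

lemma sum_intUnits (f : ℤˣ → ℝ) : ∑ s, f s = f 1 + f (-1) := by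
  simp [UnitsInt.univ]

lemma expect_clauseWeight_prod (n k : ℕ) (b : ℝ) (a : Literal n → ℝ) :
    expect (clauseWeight n k b) (fun d => ∏ j, a (d.toClause j)) =
      (2 * (n.descFactorial k : ℝ))⁻¹ * ∑ K : Fin k → Fin n with Function.Injective K,
        (∏ j, ((1 / 2 - b) * a (K j, 1) + (1 / 2 + b) * a (K j, -1)) +
          ∏ j, ((1 / 2 - b) * a (K j, -1) + (1 / 2 + b) * a (K j, 1))) := by
  have sum_sign (K : Fin k → Fin n) (B : ℤˣ) (j : Fin k) :
      (1 / 2 - b) * a (K j, B) + (1 / 2 + b) * a (K j, -B) =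
        ∑ s : ℤˣ, (1 / 2 - ((s : ℤ) : ℝ) * b) * a (K j, B * s) := by
    simp
  have sum_positionSigns (K : Fin k → Fin n) (B : ℤˣ) :
      ∑ P : Fin k → ℤˣ, clauseWeight n k b (K, B, P) * ∏ j, a (K j, B * P j) =
        (if Function.Injective K then (n.descFactorial k : ℝ)⁻¹ else 0) * (1 / 2 *
          ∏ j, ((1 / 2 - b) * a (K j, B) + (1 / 2 + b) * a (K j, -B))) := by
    simp only [sum_sign, Finset.prod_univ_sum, Fintype.piFinset_univ, Finset.prod_mul_distrib,
      clauseWeight, mul_assoc, Finset.mul_sum]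
  rw [expect, Fintype.sum_prod_type, Finset.sum_filter, Finset.mul_sum]
  refine Finset.sum_congr rfl fun K _ => ?_
  rw [Fintype.sum_prod_type]
  simp only [ClauseData.toClause, sum_positionSigns, sum_intUnits, neg_neg, mul_inv]
  split_ifs <;> ring

lemma card_injective (n k : ℕ) :
    Finset.card {K : Fin k → Fin n | Function.Injective K} = n.descFactorial k := by
  rw [← Fintype.card_subtype, Fintype.card_congr (Equiv.subtypeInjectiveEquivEmbedding _ _),
    Fintype.card_embedding_eq, Fintype.card_fin, Fintype.card_fin]

lemma sum_clauseWeight (hk : k ≤ n) (b : ℝ) : ∑ d, clauseWeight n k b d = 1 := by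
  have h := expect_clauseWeight_prod n k b fun _ => 1
  have : (n.descFactorial k : ℝ) ≠ 0 := by exact_mod_cast (Nat.descFactorial_pos.2 hk).ne'
  simp only [expect, Finset.prod_const_one, mul_one, Finset.sum_const, card_injective,
    nsmul_eq_mul, show 1 / 2 - b + (1 / 2 + b) = 1 by ring] at h
  rw [h]
  field_simp
  norm_num

lemma clauseWeight_mem_stdSimplex (hk : k ≤ n) (hb : |b| ≤ 1 / 2) :
    clauseWeight n k b ∈ stdSimplex ℝ (ClauseData n k) :=
  ⟨clauseWeight_nonneg hb, sum_clauseWeight hk b⟩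

/-- The set of variables occurring in the clause. -/
def ClauseData.vars (d : ClauseData n k) : Finset (Fin n) := Finset.univ.image d.1

/-- The same clause after renaming the variables by `φ`. -/
def ClauseData.relabel {n' : ℕ} (φ : Fin n → Fin n') (d : ClauseData n k) : ClauseData n' k :=
  (φ ∘ d.1, d.2)

lemma ClauseData.card_vars_le (d : ClauseData n k) : d.vars.card ≤ k :=
  Finset.card_image_le.trans_eq (by simp)

/-- The probability that a random clause on `n + 1` variables avoids a given variable. -/
noncomputable def avoidProb (n k : ℕ) : ℝ := 1 - k / (n + 1)

lemma inv_descFactorial_succ (hk : k ≤ n) :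
    ((n + 1).descFactorial k : ℝ)⁻¹ = avoidProb n k * (n.descFactorial k : ℝ)⁻¹ := by
  have : (n.descFactorial k : ℝ) ≠ 0 := by exact_mod_cast (Nat.descFactorial_pos.2 hk).ne'
  have : ((n + 1).descFactorial k : ℝ) ≠ 0 := by
    exact_mod_cast (Nat.descFactorial_pos.2 (hk.trans n.le_succ)).ne'
  have : (n : ℝ) + 1 ≠ 0 := by positivity
  have succ_mul : ((n : ℝ) + 1 - k) * (n + 1).descFactorial k = (n + 1) * n.descFactorial k := by
    have h := congrArg (Nat.cast (R := ℝ)) (Nat.succ_descFactorial n k)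
    push_cast [hk.trans n.le_succ] at h
    exact h
  unfold avoidProb
  field_simp
  linarith

lemma clauseWeight_relabel_succAbove (hk : k ≤ n) (b : ℝ) (v : Fin (n + 1)) (d : ClauseData n k) :
    clauseWeight (n + 1) k b (d.relabel v.succAbove) = avoidProb n k * clauseWeight n k b d := by
  have injective_iff : Function.Injective (v.succAbove ∘ d.1) ↔ Function.Injective d.1 :=
    (Fin.succAbove_right_injective (p := v)).of_comp_iff d.1
  simp only [clauseWeight, ClauseData.relabel, injective_iff, inv_descFactorial_succ hk]
  split_ifs <;> ring

lemma sum_avoiding_eq_sum_relabel_succAbove (v : Fin (n + 1)) (h : ClauseData (n + 1) k → ℝ) :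
    ∑ d : ClauseData (n + 1) k with v ∉ d.vars, h d =
      ∑ d : ClauseData n k, h (d.relabel v.succAbove) := by
  have image_relabel : (Finset.univ.filter fun d : ClauseData (n + 1) k => v ∉ d.vars) =
      Finset.univ.image (ClauseData.relabel v.succAbove) := by
    ext d
    simp only [ClauseData.vars, Finset.mem_filter, Finset.mem_univ, true_and, Finset.mem_image,
      not_exists]
    refine ⟨fun hd => ?_, ?_⟩
    · choose K hK using fun j => Fin.exists_succAbove_eq (hd j)
      exact ⟨(K, d.2), Prod.ext (funext hK) rfl⟩
    · rintro ⟨d, rfl⟩ j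
      exact Fin.succAbove_ne _ _
  rw [image_relabel, Finset.sum_image]
  exact (Fin.succAbove_right_injective.comp_left.prodMap Function.injective_id).injOn

lemma expect_clauseWeight_avoiding (hk : k ≤ n) (b : ℝ) (v : Fin (n + 1))
    (g : ClauseData (n + 1) k → ℝ) :
    expect (clauseWeight (n + 1) k b) (fun d => if v ∉ d.vars then g d else 0) =
      avoidProb n k * expect (clauseWeight n k b) fun d => g (d.relabel v.succAbove) := by
  simp only [expect, mul_ite, mul_zero, Finset.mul_sum]
  rw [← Finset.sum_filter, sum_avoiding_eq_sum_relabel_succAbove]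
  simp only [clauseWeight_relabel_succAbove hk, mul_assoc]

end RandomClause

section Satisfiability

variable {n n' k m : ℕ}

/-- The formula with the clause data `F` is satisfiable. -/
def IsSat (F : Fin m → ClauseData n k) : Prop := Formula.Satisfiable fun i => (F i).toClause

open Classical in
/-- The indicator function of `IsSat`. -/
noncomputable def satInd (F : Fin m → ClauseData n k) : ℝ := if IsSat F then 1 else 0

lemma satInd_mem_Icc (F : Fin m → ClauseData n k) : satInd F ∈ Set.Icc 0 1 := by
  unfold satInd
  split_ifs <;> simp

lemma satInd_congr {m' : ℕ} {F : Fin m → ClauseData n k} {G : Fin m' → ClauseData n' k}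
    (h : IsSat F ↔ IsSat G) : satInd F = satInd G := by
  unfold satInd
  congr 1
  exact propext h

lemma isSat_insertNth {F : Fin m → ClauseData n k} {d : ClauseData n k} (i : Fin (m + 1)) :
    IsSat (i.insertNth d F : Fin (m + 1) → ClauseData n k) ↔
      ∃ σ, d.toClause.Holds σ ∧ ∀ l, (F l).toClause.Holds σ := by
  simp only [IsSat, Formula.Satisfiable, Fin.forall_iff_succAbove i, Fin.insertNth_apply_same,
    Fin.insertNth_apply_succAbove]

lemma holds_relabel {φ : Fin n → Fin n'} {d : ClauseData n k} {σ : Assignment n'} :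
    (d.relabel φ).toClause.Holds σ ↔ d.toClause.Holds (σ ∘ φ) := Iff.rfl

lemma isSat_relabel {φ : Fin n → Fin n'} (hφ : Function.Injective φ)
    (F : Fin m → ClauseData n k) : IsSat (ClauseData.relabel φ ∘ F) ↔ IsSat F := by
  refine ⟨fun ⟨σ, h⟩ => ⟨σ ∘ φ, h⟩, fun ⟨σ, h⟩ => ⟨Function.extend φ σ 1, fun i => ?_⟩⟩
  exact holds_relabel.2 (by rw [Function.extend_comp hφ]; exact h i)

/-- The variable outside the range of `φ` occurs in no other clause, so it is free to satisfy
`d`. -/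
lemma isSat_insertNth_relabel {φ : Fin n → Fin n'} (hφ : Function.Injective φ)
    (F : Fin m → ClauseData n k) {v : Fin n'} (hv : v ∉ Set.range φ) {d : ClauseData n' k}
    (hd : v ∈ d.vars) (i : Fin (m + 1)) :
    IsSat (i.insertNth d (ClauseData.relabel φ ∘ F) : Fin (m + 1) → ClauseData n' k) ↔
      IsSat F := by
  rw [isSat_insertNth]
  refine ⟨fun ⟨σ, _, h⟩ => ⟨σ ∘ φ, h⟩, fun ⟨σ, h⟩ => ?_⟩
  obtain ⟨j, -, rfl⟩ := Finset.mem_image.1 hd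
  refine ⟨Function.extend φ σ fun _ => (d.toClause j).2, ⟨j, ?_⟩, fun l => ?_⟩
  · exact Function.extend_apply' _ _ _ hv
  · exact holds_relabel.2 (by rw [Function.extend_comp hφ]; exact h l)

end Satisfiability

section Occurrences

variable {n k m : ℕ}

/-- The number of clauses of `F` in which the variable `v` occurs. -/
def occ (v : Fin n) (F : Fin m → ClauseData n k) : ℕ := Finset.card {i | v ∈ (F i).vars}

/-- The number of variables that occur in exactly `t` clauses of `F`. -/
def numOcc (t : ℕ) (F : Fin m → ClauseData n k) : ℕ := Finset.card {v | occ v F = t}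

lemma occ_eq_zero_iff {v : Fin n} {F : Fin m → ClauseData n k} :
    occ v F = 0 ↔ ∀ i, v ∉ (F i).vars := by
  simp [occ, Finset.filter_eq_empty_iff]

lemma occ_insertNth (v : Fin n) (i : Fin (m + 1)) (d : ClauseData n k)
    (F : Fin m → ClauseData n k) :
    occ v (i.insertNth d F : Fin (m + 1) → ClauseData n k) =
      (if v ∈ d.vars then 1 else 0) + occ v F := by
  simp only [occ, Finset.card_filter, Fin.sum_univ_succAbove _ i, Fin.insertNth_apply_same,
    Fin.insertNth_apply_succAbove]

lemma numOcc_le_add {F G : Fin m → ClauseData n k} {i : Fin m} (h : ∀ l ≠ i, F l = G l) (t : ℕ) :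
    numOcc t F ≤ numOcc t G + 2 * k := by
  have occ_eq (v : Fin n) (hF : v ∉ (F i).vars) (hG : v ∉ (G i).vars) : occ v F = occ v G := by
    refine congrArg Finset.card (Finset.filter_congr fun l _ => ?_)
    obtain rfl | hl := eq_or_ne l i
    · simp only [hF, hG]
    · rw [h l hl]
  calc numOcc t F
      ≤ Finset.card (Finset.univ.filter (fun v => occ v G = t) ∪ ((F i).vars ∪ (G i).vars)) := by
        refine Finset.card_le_card fun v hv => ?_
        simp only [Finset.mem_filter, Finset.mem_univ, true_and, Finset.mem_union] at hv ⊢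
        by_contra! hnot
        exact hnot.1 (occ_eq v hnot.2.1 hnot.2.2 ▸ hv)
    _ ≤ numOcc t G + ((F i).vars.card + (G i).vars.card) :=
        (Finset.card_union_le _ _).trans (Nat.add_le_add_left (Finset.card_union_le _ _) _)
    _ ≤ numOcc t G + 2 * k := by
        have := (F i).card_vars_le
        have := (G i).card_vars_le
        omega

lemma abs_numOcc_update_sub_le (t : ℕ) (F : Fin m → ClauseData n k) (i : Fin m)
    (d : ClauseData n k) :
    |(numOcc t (Function.update F i d) : ℝ) - numOcc t F| ≤ 2 * k := by
  have le : numOcc t (Function.update F i d) ≤ numOcc t F + 2 * k :=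
    numOcc_le_add (fun l hl => Function.update_of_ne hl d F) t
  have ge : numOcc t F ≤ numOcc t (Function.update F i d) + 2 * k :=
    numOcc_le_add (fun l hl => (Function.update_of_ne hl d F).symm) t
  rw [abs_le]
  constructor <;> [rify at ge; rify at le] <;> linarith

lemma numOcc_mul (t : ℕ) (F : Fin m → ClauseData n k) (x : ℝ) :
    numOcc t F * x = ∑ v, if occ v F = t then x else 0 := by
  rw [numOcc, ← nsmul_eq_mul, ← Finset.sum_const, Finset.sum_filter]

lemma expect_ite_occ_eq_zero (hk : k ≤ n) (b : ℝ) (v : Fin (n + 1))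
    (f : (Fin m → ClauseData (n + 1) k) → ℝ) :
    expect (iidWeight (clauseWeight (n + 1) k b)) (fun F => if occ v F = 0 then f F else 0) =
      avoidProb n k ^ m * expect (iidWeight (clauseWeight n k b))
        fun F => f (ClauseData.relabel v.succAbove ∘ F) := by
  simp only [occ_eq_zero_iff]
  exact expect_iidWeight_restrict (expect_clauseWeight_avoiding hk b v) f

lemma expect_ite_mem_vars (hk : k ≤ n) (b : ℝ) (v : Fin (n + 1)) (x : ℝ) :
    expect (clauseWeight (n + 1) k b) (fun d => if v ∈ d.vars then x else 0) =
      k / (n + 1) * x := by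
  have compl (d : ClauseData (n + 1) k) :
      (if v ∈ d.vars then x else 0) = x - if v ∉ d.vars then x else 0 := by
    split_ifs <;> simp_all
  simp only [compl]
  rw [expect_sub, expect_clauseWeight_avoiding hk, expect_const (sum_clauseWeight hk b),
    expect_const (sum_clauseWeight (hk.trans n.le_succ) b), avoidProb]
  ring

lemma expect_numOcc_zero_mul (hk : k ≤ n) (b : ℝ) {f : (Fin m → ClauseData (n + 1) k) → ℝ}
    {g : (Fin m → ClauseData n k) → ℝ}
    (hfg : ∀ v F, f (ClauseData.relabel (Fin.succAbove v) ∘ F) = g F) :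
    expect (iidWeight (clauseWeight (n + 1) k b)) (fun F => numOcc 0 F * f F) =
      (n + 1) * avoidProb n k ^ m * expect (iidWeight (clauseWeight n k b)) g := by
  simp only [numOcc_mul, expect_sum, expect_ite_occ_eq_zero hk, hfg, Finset.sum_const,
    Finset.card_univ, Fintype.card_fin, nsmul_eq_mul, mul_assoc]
  push_cast
  rfl

lemma numOcc_one_mul (F : Fin m → ClauseData n k) (x : ℝ) :
    numOcc 1 F * x = ∑ v, ∑ i, if v ∈ (F i).vars then (if occ v F = 1 then x else 0) else 0 := by
  rw [numOcc_mul]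
  refine Finset.sum_congr rfl fun v _ => ?_
  rw [← Finset.sum_filter, Finset.sum_const, ← occ]
  split_ifs with h <;> simp [h]

lemma expect_numOcc_one_mul (hk : k ≤ n) (b : ℝ) {f : (Fin (m + 1) → ClauseData (n + 1) k) → ℝ}
    {g : (Fin m → ClauseData n k) → ℝ}
    (hfg : ∀ v i d F, v ∈ ClauseData.vars d →
      f (Fin.insertNth i d (ClauseData.relabel (Fin.succAbove v) ∘ F)) = g F) :
    expect (iidWeight (clauseWeight (n + 1) k b)) (fun F => numOcc 1 F * f F) =
      (m + 1) * k * avoidProb n k ^ m * expect (iidWeight (clauseWeight n k b)) g := by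
  have only_in (v : Fin (n + 1)) (i : Fin (m + 1)) : expect (iidWeight (clauseWeight (n + 1) k b))
      (fun F => if v ∈ (F i).vars then (if occ v F = 1 then f F else 0) else 0) =
        k / (n + 1) * (avoidProb n k ^ m * expect (iidWeight (clauseWeight n k b)) g) := by
    rw [expect_iidWeight_insertNth _ i, ← expect_ite_mem_vars hk b v]
    refine congrArg (expect _) (funext fun d => ?_)
    by_cases hd : v ∈ d.vars
    · simp only [Fin.insertNth_apply_same, hd, if_true, occ_insertNth, Nat.add_eq_left,
        expect_ite_occ_eq_zero hk, hfg v i d _ hd]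
    · simp only [Fin.insertNth_apply_same, hd, if_false, expect, mul_zero, Finset.sum_const_zero]
  simp only [numOcc_one_mul, expect_sum, only_in, Finset.sum_const, Finset.card_univ,
    Fintype.card_fin, nsmul_eq_mul]
  push_cast
  field_simp

end Occurrences

section SatPoly

variable {n k m : ℕ} {b : ℝ}

/-- The polynomial in `b` that agrees with `satProb n k m` on `[-1/2, 1/2]`. -/
noncomputable def satPoly (n k m : ℕ) (b : ℝ) : ℝ :=
  expect (iidWeight (clauseWeight n k b)) (satInd (m := m))

lemma avoidProb_pos (hk : k ≤ n) : 0 < avoidProb n k := by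
  have : (k : ℝ) < n + 1 := by exact_mod_cast Nat.lt_succ_of_le hk
  rw [avoidProb, sub_pos, div_lt_one (by positivity)]
  exact this

/-- A variable that occurs in no clause can be deleted without affecting satisfiability, and the
number of such variables is concentrated. -/
lemma abs_satPoly_sub_satPoly_succ_le (hk : k ≤ n) (hb : |b| ≤ 1 / 2) :
    (n + 1) * avoidProb n k ^ m * |satPoly n k m b - satPoly (n + 1) k m b| ≤ 2 * k * √m := by
  have hw := clauseWeight_mem_stdSimplex (hk.trans n.le_succ) hb
  have mean : expect (iidWeight (clauseWeight (n + 1) k b)) (fun F : Fin m → _ => (numOcc 0 F : ℝ))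
      = (n + 1) * avoidProb n k ^ m := by
    have h := expect_numOcc_zero_mul (m := m) hk b (f := fun _ => 1) (g := fun _ => 1)
      fun _ _ => rfl
    rwa [expect_const (iidWeight_mem_stdSimplex (clauseWeight_mem_stdSimplex hk hb)).2, mul_one,
      funext fun F => mul_one _] at h
  have mean_sat := expect_numOcc_zero_mul (m := m) hk b (f := satInd) (g := satInd) fun v F =>
    satInd_congr (isSat_relabel Fin.succAbove_right_injective F)
  have h := abs_expect_mul_sub_le hw (Y := fun F : Fin m → _ => (numOcc 0 F : ℝ))
    (by positivity : (0 : ℝ) ≤ 2 * k) (abs_numOcc_update_sub_le 0) satInd_mem_Icc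
  rwa [mean, mean_sat, ← mul_sub, abs_mul, abs_of_nonneg] at h
  exact mul_nonneg (by positivity) (pow_nonneg (avoidProb_pos hk).le m)

/-- A clause containing a variable that occurs nowhere else can be deleted together with that
variable, and the number of such variables is concentrated. -/
lemma abs_satPoly_sub_satPoly_succ_succ_le (hk : k ≤ n) (hb : |b| ≤ 1 / 2) :
    (m + 1) * k * avoidProb n k ^ m * |satPoly n k m b - satPoly (n + 1) k (m + 1) b| ≤
      2 * k * √(m + 1) := by
  have hw := clauseWeight_mem_stdSimplex (hk.trans n.le_succ) hb
  have mean : expect (iidWeight (clauseWeight (n + 1) k b))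
      (fun F : Fin (m + 1) → _ => (numOcc 1 F : ℝ)) = (m + 1) * k * avoidProb n k ^ m := by
    have h := expect_numOcc_one_mul (m := m) hk b (f := fun _ => 1) (g := fun _ => 1)
      fun _ _ _ _ _ => rfl
    rwa [expect_const (iidWeight_mem_stdSimplex (clauseWeight_mem_stdSimplex hk hb)).2, mul_one,
      funext fun F => mul_one _] at h
  have mean_sat := expect_numOcc_one_mul (m := m) hk b (f := satInd) (g := satInd)
    fun v i d F hd => satInd_congr
      (isSat_insertNth_relabel Fin.succAbove_right_injective F (by simp) hd i)
  have h := abs_expect_mul_sub_le hw (Y := fun F : Fin (m + 1) → _ => (numOcc 1 F : ℝ))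
    (by positivity : (0 : ℝ) ≤ 2 * k) (abs_numOcc_update_sub_le 1) satInd_mem_Icc
  rw [mean, mean_sat, ← mul_sub, abs_mul, abs_of_nonneg] at h
  · exact_mod_cast h
  · exact mul_nonneg (by positivity) (pow_nonneg (avoidProb_pos hk).le m)

lemma exp_neg_le_avoidProb_pow {r : ℝ} (hk : k ≤ n) (hm : m ≤ r * n) :
    Real.exp (-(k ^ 2 * r)) ≤ avoidProb n k ^ m := by
  have hkn : (k : ℝ) ≤ n := by exact_mod_cast hk
  have gap_pos : (0 : ℝ) < n + 1 - k := by linarith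
  have one_sub_inv : 1 - (avoidProb n k)⁻¹ = -(k / (n + 1 - k)) := by
    have : avoidProb n k = (n + 1 - k) / (n + 1) := by unfold avoidProb; field_simp
    rw [this]
    field_simp
    ring
  have ratio_le : m * (k / (n + 1 - k)) ≤ k ^ 2 * r := by
    rw [mul_div_assoc', div_le_iff₀ gap_pos]
    obtain rfl | hk0 := Nat.eq_zero_or_pos k
    · simp
    · have hk1 : (1 : ℝ) ≤ k := by exact_mod_cast hk0
      have hr : 0 ≤ r := nonneg_of_mul_nonneg_left (hm.trans' m.cast_nonneg) (by linarith)
      calc (m : ℝ) * k ≤ r * n * k := by gcongr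
        _ ≤ r * (k * (n + 1 - k)) * k := by
            gcongr
            nlinarith
        _ = k ^ 2 * r * (n + 1 - k) := by ring
  calc Real.exp (-(k ^ 2 * r)) ≤ Real.exp (m * Real.log (avoidProb n k)) := by
        have := Real.one_sub_inv_le_log_of_pos (avoidProb_pos hk)
        rw [one_sub_inv] at this
        refine Real.exp_le_exp.2 ?_
        nlinarith [mul_le_mul_of_nonneg_left this m.cast_nonneg]
    _ = avoidProb n k ^ m := by rw [Real.exp_nat_mul, Real.exp_log (avoidProb_pos hk)]

lemma mul_abs_satPoly_sub_satPoly_succ_le {r : ℝ} (hr : 0 ≤ r) (hk : k ≤ n) (hb : |b| ≤ 1 / 2)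
    (hm : m ≤ r * n) :
    m * Real.exp (-(k ^ 2 * r)) * |satPoly n k m b - satPoly (n + 1) k m b| ≤ 2 * k * r * √m :=
  calc m * Real.exp (-(k ^ 2 * r)) * |satPoly n k m b - satPoly (n + 1) k m b|
      ≤ r * (n + 1) * avoidProb n k ^ m * |satPoly n k m b - satPoly (n + 1) k m b| := by
        gcongr
        · linarith
        · exact exp_neg_le_avoidProb_pow hk hm
    _ = r * ((n + 1) * avoidProb n k ^ m * |satPoly n k m b - satPoly (n + 1) k m b|) := by ring
    _ ≤ r * (2 * k * √m) :=
        mul_le_mul_of_nonneg_left (abs_satPoly_sub_satPoly_succ_le hk hb) hr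
    _ = 2 * k * r * √m := by ring

lemma mul_abs_satPoly_sub_satPoly_succ_succ_le {r : ℝ} (hk0 : 0 < k) (hk : k ≤ n)
    (hb : |b| ≤ 1 / 2) (hm : m ≤ r * n) :
    (m + 1) * Real.exp (-(k ^ 2 * r)) * |satPoly n k m b - satPoly (n + 1) k (m + 1) b| ≤
      2 * √(m + 1) := by
  have hk0' : (0 : ℝ) < k := by exact_mod_cast hk0
  refine le_of_mul_le_mul_left ?_ hk0'
  calc k * ((m + 1) * Real.exp (-(k ^ 2 * r)) * |satPoly n k m b - satPoly (n + 1) k (m + 1) b|)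
      = (m + 1) * k * Real.exp (-(k ^ 2 * r)) *
          |satPoly n k m b - satPoly (n + 1) k (m + 1) b| := by ring
    _ ≤ (m + 1) * k * avoidProb n k ^ m * |satPoly n k m b - satPoly (n + 1) k (m + 1) b| := by
        gcongr
        exact exp_neg_le_avoidProb_pow hk hm
    _ ≤ 2 * k * √(m + 1) := abs_satPoly_sub_satPoly_succ_succ_le hk hb
    _ = k * (2 * √(m + 1)) := by ring

/-- The constant in `satPoly_sub_satPoly_succ_le`. -/
noncomputable def dropConst (k : ℕ) (r : ℝ) : ℝ :=
  2 * (1 + k * r) * Real.exp (k ^ 2 * r) * √r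

lemma satPoly_sub_satPoly_succ_le {r : ℝ} (hk0 : 0 < k) (hk : k ≤ n) (hb : |b| ≤ 1 / 2)
    (hm : m + 1 ≤ r * n) :
    (m + 1) * (satPoly n k m b - satPoly n k (m + 1) b) ≤ dropConst k r * √n := by
  have hr : 0 ≤ r := nonneg_of_mul_nonneg_left (hm.trans' (by positivity))
    (by exact_mod_cast hk0.trans_le hk)
  have delete_clause := mul_abs_satPoly_sub_satPoly_succ_succ_le hk0 hk hb
    (hm.trans' (le_add_of_nonneg_right zero_le_one))
  have delete_variable := mul_abs_satPoly_sub_satPoly_succ_le hr hk hb (m := m + 1)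
    (by exact_mod_cast hm)
  push_cast at delete_variable
  set E := Real.exp (-(k ^ 2 * r)) with hE
  have E_pos : 0 < E := Real.exp_pos _
  calc (m + 1) * (satPoly n k m b - satPoly n k (m + 1) b)
      ≤ 2 * (1 + k * r) * √(m + 1) / E := by
        rw [le_div_iff₀ E_pos]
        have h₁ := mul_le_mul_of_nonneg_left (le_abs_self
          (satPoly n k m b - satPoly (n + 1) k (m + 1) b)) (by positivity : 0 ≤ (m + 1) * E)
        have h₂ := mul_le_mul_of_nonneg_left (neg_abs_le
          (satPoly n k (m + 1) b - satPoly (n + 1) k (m + 1) b)) (by positivity : 0 ≤ (m + 1) * E)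
        linarith
    _ ≤ 2 * (1 + k * r) * √(r * n) / E := by gcongr
    _ = dropConst k r * √n := by
        rw [dropConst, hE, Real.exp_neg, div_inv_eq_mul, Real.sqrt_mul hr]
        ring

end SatPoly

section InjectiveTuples

variable {ι : Type*} {k : ℕ} {e β : ι → ℝ} {b : ℝ}

lemma abs_mul_le_half {x y : ℝ} (hb : |b| ≤ 1 / 2) (hy : |y| ≤ x) : |b * y| ≤ x / 2 :=
  calc |b * y| = |b| * |y| := abs_mul b y
    _ ≤ 1 / 2 * x := by gcongr
    _ = x / 2 := by ring

lemma abs_half_add_mul_le {x y : ℝ} (hb : |b| ≤ 1 / 2) (hy : |y| ≤ x) : |x / 2 + b * y| ≤ x := by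
  obtain ⟨h₁, h₂⟩ := abs_le.1 (abs_mul_le_half hb hy)
  exact abs_le.2 ⟨by linarith [(abs_nonneg y).trans hy], by linarith⟩

/-- The product of the values of `e / 2 + b β` along the tuple `K`. -/
noncomputable def tupleProd (e β : ι → ℝ) (b : ℝ) (K : Fin k → ι) : ℝ :=
  ∏ j, (e (K j) / 2 + b * β (K j))

lemma abs_tupleProd_le (hβ : ∀ v, |β v| ≤ e v) (hb : |b| ≤ 1 / 2) (K : Fin k → ι) :
    |tupleProd e β b K| ≤ ∏ j, e (K j) :=
  (Finset.abs_prod _ _).trans_le <|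
    Finset.prod_le_prod (fun _ _ => abs_nonneg _) fun _ _ => abs_half_add_mul_le hb (hβ _)

lemma differentiable_tupleProd (e β : ι → ℝ) (K : Fin k → ι) :
    Differentiable ℝ fun b => tupleProd e β b K := by
  unfold tupleProd
  fun_prop

lemma abs_deriv_tupleProd_le (hβ : ∀ v, |β v| ≤ e v) (hb : |b| ≤ 1 / 2) (K : Fin k → ι) :
    |deriv (fun b => tupleProd e β b K) b| ≤ k * ∏ j, e (K j) := by
  have derivative : HasDerivAt (fun b => tupleProd e β b K) _ b :=
    HasDerivAt.fun_finsetProd fun j _ =>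
      ((hasDerivAt_id b).mul_const (β (K j))).const_add (e (K j) / 2)
  rw [derivative.deriv]
  calc _ ≤ ∑ _j : Fin k, ∏ j, e (K j) := by
        refine (Finset.abs_sum_le_sum_abs _ _).trans (Finset.sum_le_sum fun j _ => ?_)
        rw [smul_eq_mul, one_mul, abs_mul, Finset.abs_prod,
          ← Finset.prod_erase_mul _ _ (Finset.mem_univ j)]
        exact mul_le_mul (Finset.prod_le_prod (fun _ _ => abs_nonneg _)
          fun i _ => abs_half_add_mul_le hb (hβ _)) (hβ _) (abs_nonneg _)
          (Finset.prod_nonneg fun _ _ => (abs_nonneg _).trans (hβ _))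
    _ = k * ∏ j, e (K j) := by simp

lemma differentiable_tupleProd_add_neg (e β : ι → ℝ) (K : Fin k → ι) :
    Differentiable ℝ fun b => tupleProd e β b K + tupleProd e β (-b) K := by
  have := differentiable_tupleProd e β K
  fun_prop

lemma deriv_tupleProd_add_neg_le (hβ : ∀ v, |β v| ≤ e v) (hb : |b| ≤ 1 / 2) (K : Fin k → ι) :
    deriv (fun b => tupleProd e β b K + tupleProd e β (-b) K) b ≤ 2 * k * ∏ j, e (K j) := by
  have differentiable := differentiable_tupleProd e β K
  rw [deriv_fun_add (by fun_prop) (by fun_prop), deriv_comp_neg fun b => tupleProd e β b K]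
  have h₁ := le_of_abs_le (abs_deriv_tupleProd_le hβ hb K)
  have h₂ := neg_le_of_abs_le (abs_deriv_tupleProd_le hβ ((abs_neg b).trans_le hb) K)
  linarith

variable [Fintype ι]

lemma abs_sum_le_sum (hβ : ∀ v, |β v| ≤ e v) : |∑ v, β v| ≤ ∑ v, e v :=
  (Finset.abs_sum_le_sum_abs _ _).trans (Finset.sum_le_sum fun v _ => hβ v)

lemma sum_tupleProd (k : ℕ) (e β : ι → ℝ) (b : ℝ) :
    ∑ K : Fin k → ι, tupleProd e β b K = ((∑ v, e v) / 2 + b * ∑ v, β v) ^ k := by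
  rw [Finset.sum_div, Finset.mul_sum, ← Finset.sum_add_distrib, Fintype.sum_pow]
  rfl

lemma deriv_sum_tupleProd_nonneg (k : ℕ) (hβ : ∀ v, |β v| ≤ e v) (hb : b ∈ Set.Icc 0 (1 / 2)) :
    0 ≤ deriv (fun b => ∑ K : Fin k → ι, (tupleProd e β b K + tupleProd e β (-b) K)) b := by
  set s := ∑ v, e v
  set d := ∑ v, β v
  have derivative : HasDerivAt (fun b => (s / 2 + b * d) ^ k + (s / 2 + -b * d) ^ k)
      (k * (s / 2 + b * d) ^ (k - 1) * d + k * (s / 2 + -b * d) ^ (k - 1) * (-d)) b := by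
    simpa using
      (((hasDerivAt_id b).mul_const d).const_add (s / 2)).fun_pow k |>.fun_add <|
      (((hasDerivAt_neg b).mul_const d).const_add (s / 2)).fun_pow k
  simp only [Finset.sum_add_distrib, sum_tupleProd]
  rw [derivative.deriv]
  obtain ⟨h₁, h₂⟩ := abs_le.1 (abs_mul_le_half (abs_le.2 ⟨by linarith [hb.1], hb.2⟩)
    (abs_sum_le_sum hβ))
  calc 0 ≤ k * (((s / 2 + b * d) ^ (k - 1) - (s / 2 + -b * d) ^ (k - 1)) * d) := by
        refine mul_nonneg k.cast_nonneg ?_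
        obtain hd | hd := le_total 0 d
        · have := mul_nonneg hb.1 hd
          exact mul_nonneg (sub_nonneg.2 (pow_le_pow_left₀ (by linarith) (by linarith) _)) hd
        · have := mul_nonpos_of_nonneg_of_nonpos hb.1 hd
          exact mul_nonneg_of_nonpos_of_nonpos
            (sub_nonpos.2 (pow_le_pow_left₀ (by linarith) (by linarith) _)) hd
    _ = _ := by ring

variable [DecidableEq ι]

lemma sum_prod_of_eq_le (he : ∀ v, e v ∈ Set.Icc 0 1) {j l : Fin k} (hjl : j ≠ l) :
    ∑ K : Fin k → ι with K j = K l, ∏ i, e (K i) ≤ (∑ v, e v) ^ (k - 1) := by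
  cases k with
  | zero => exact j.elim0
  | succ k =>
    obtain ⟨l, rfl⟩ := Fin.exists_succAbove_eq hjl.symm
    rw [Finset.sum_filter, ← (Fin.insertNthEquiv (fun _ => ι) j).sum_comp,
      Fintype.sum_prod_type_right, Nat.add_sub_cancel, Fintype.sum_pow]
    refine Finset.sum_le_sum fun K _ => ?_
    simp only [Fin.insertNthEquiv_apply, Fin.insertNth_apply_same, Fin.insertNth_apply_succAbove,
      Fin.prod_univ_succAbove _ j, Finset.sum_ite_eq', Finset.mem_univ, if_true]
    exact mul_le_of_le_one_left (Finset.prod_nonneg fun _ _ => (he _).1) (he _).2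

lemma sum_not_injective_prod_le (he : ∀ v, e v ∈ Set.Icc 0 1) :
    ∑ K : Fin k → ι with ¬ Function.Injective K, ∏ j, e (K j) ≤
      k ^ 2 * (∑ v, e v) ^ (k - 1) := by
  have prod_nonneg (K : Fin k → ι) : 0 ≤ ∏ j, e (K j) :=
    Finset.prod_nonneg fun _ _ => (he _).1
  have sum_nonneg : 0 ≤ ∑ v, e v := Finset.sum_nonneg fun v _ => (he v).1
  let pairs := (Finset.univ : Finset (Fin k)).offDiag
  have union_bound (K : Fin k → ι) (hK : ¬ Function.Injective K) :
      ∏ j, e (K j) ≤ ∑ p ∈ pairs, if K p.1 = K p.2 then ∏ j, e (K j) else 0 := by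
    obtain ⟨j, l, h, hjl⟩ := Function.not_injective_iff.1 hK
    exact (if_pos h).ge.trans (Finset.single_le_sum
      (f := fun p : Fin k × Fin k => if K p.1 = K p.2 then ∏ j, e (K j) else 0)
      (fun p _ => ite_nonneg (prod_nonneg K) le_rfl) (a := (j, l)) (by simp [pairs, hjl]))
  calc ∑ K : Fin k → ι with ¬ Function.Injective K, ∏ j, e (K j)
      ≤ ∑ K : Fin k → ι, ∑ p ∈ pairs, if K p.1 = K p.2 then ∏ j, e (K j) else 0 := by
        rw [Finset.sum_filter]
        refine Finset.sum_le_sum fun K _ => ?_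
        split_ifs with hK
        · exact Finset.sum_nonneg fun p _ => ite_nonneg (prod_nonneg K) le_rfl
        · exact union_bound K hK
    _ = ∑ p ∈ pairs, ∑ K : Fin k → ι with K p.1 = K p.2, ∏ j, e (K j) := by
        rw [Finset.sum_comm]
        simp only [Finset.sum_filter]
    _ ≤ ∑ _p ∈ pairs, (∑ v, e v) ^ (k - 1) :=
        Finset.sum_le_sum fun _ hp => sum_prod_of_eq_le he (Finset.mem_offDiag.1 hp).2.2
    _ ≤ k ^ 2 * (∑ v, e v) ^ (k - 1) := by
        rw [Finset.sum_const, nsmul_eq_mul]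
        gcongr
        rw [Finset.offDiag_card, Finset.card_fin, sq]
        exact_mod_cast Nat.sub_le _ _

/-- The sum of `∏ j, (e / 2 + b β) + ∏ j, (e / 2 - b β)` over all `k`-tuples of distinct indices. -/
noncomputable def injTupleSum (k : ℕ) (e β : ι → ℝ) (b : ℝ) : ℝ :=
  ∑ K : Fin k → ι with Function.Injective K, (tupleProd e β b K + tupleProd e β (-b) K)

lemma injTupleSum_eq (k : ℕ) (e β : ι → ℝ) (b : ℝ) :
    injTupleSum k e β b =
      ((∑ v, e v) / 2 + b * ∑ v, β v) ^ k + ((∑ v, e v) / 2 - b * ∑ v, β v) ^ k -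
        ∑ K : Fin k → ι with ¬ Function.Injective K,
          (tupleProd e β b K + tupleProd e β (-b) K) := by
  rw [eq_sub_iff_add_eq, injTupleSum, Finset.sum_filter_add_sum_filter_not,
    Finset.sum_add_distrib, sum_tupleProd, sum_tupleProd, neg_mul, sub_eq_add_neg]

lemma le_injTupleSum (he : ∀ v, e v ≤ 1) (hβ : ∀ v, |β v| ≤ e v) (hb : |b| ≤ 1 / 2) :
    (∑ v, e v) ^ k / 2 ^ (k - 1) - 2 * k ^ 2 * (∑ v, e v) ^ (k - 1) ≤ injTupleSum k e β b := by
  have he' : ∀ v, e v ∈ Set.Icc 0 1 := fun v => ⟨(abs_nonneg _).trans (hβ v), he v⟩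
  have all_tuples : (∑ v, e v) ^ k / 2 ^ (k - 1) ≤
      ((∑ v, e v) / 2 + b * ∑ v, β v) ^ k + ((∑ v, e v) / 2 - b * ∑ v, β v) ^ k := by
    obtain ⟨h₁, h₂⟩ := abs_le.1 (abs_mul_le_half hb (abs_sum_le_sum hβ))
    have := add_pow_le (a := (∑ v, e v) / 2 + b * ∑ v, β v)
      (b := (∑ v, e v) / 2 - b * ∑ v, β v) (by linarith) (by linarith) k
    rwa [add_add_sub_cancel, add_halves, ← div_le_iff₀' (by positivity)] at this
  have non_injective : ∑ K : Fin k → ι with ¬ Function.Injective K,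
      (tupleProd e β b K + tupleProd e β (-b) K) ≤ 2 * (k ^ 2 * (∑ v, e v) ^ (k - 1)) :=
    calc _ ≤ ∑ K : Fin k → ι with ¬ Function.Injective K, 2 * ∏ j, e (K j) := by
          refine Finset.sum_le_sum fun K _ => ?_
          rw [two_mul]
          exact add_le_add (le_of_abs_le (abs_tupleProd_le hβ hb K))
            (le_of_abs_le (abs_tupleProd_le hβ ((abs_neg b).trans_le hb) K))
      _ ≤ 2 * (k ^ 2 * (∑ v, e v) ^ (k - 1)) := by
          rw [← Finset.mul_sum]
          exact mul_le_mul_of_nonneg_left (sum_not_injective_prod_le he') two_pos.le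
  rw [injTupleSum_eq]
  linarith

lemma le_deriv_injTupleSum (he : ∀ v, e v ≤ 1) (hβ : ∀ v, |β v| ≤ e v)
    (hb : b ∈ Set.Icc 0 (1 / 2)) :
    -(2 * k ^ 3 * (∑ v, e v) ^ (k - 1)) ≤ deriv (injTupleSum k e β) b := by
  have he' : ∀ v, e v ∈ Set.Icc 0 1 := fun v => ⟨(abs_nonneg _).trans (hβ v), he v⟩
  have deriv_split : deriv (injTupleSum k e β) b +
      ∑ K : Fin k → ι with ¬ Function.Injective K,
        deriv (fun b => tupleProd e β b K + tupleProd e β (-b) K) b =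
      deriv (fun b => ∑ K : Fin k → ι, (tupleProd e β b K + tupleProd e β (-b) K)) b := by
    unfold injTupleSum
    rw [deriv_fun_sum fun K _ => differentiable_tupleProd_add_neg e β K b,
      deriv_fun_sum fun K _ => differentiable_tupleProd_add_neg e β K b,
      Finset.sum_filter_add_sum_filter_not]
  have non_injective : ∑ K : Fin k → ι with ¬ Function.Injective K,
      deriv (fun b => tupleProd e β b K + tupleProd e β (-b) K) b ≤
        2 * k * (k ^ 2 * (∑ v, e v) ^ (k - 1)) := by
    refine (Finset.sum_le_sum fun K _ =>
      deriv_tupleProd_add_neg_le hβ (abs_le.2 ⟨by linarith [hb.1], hb.2⟩) K).trans ?_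
    rw [← Finset.mul_sum]
    exact mul_le_mul_of_nonneg_left (sum_not_injective_prod_le he') (by positivity)
  linarith [deriv_sum_tupleProd_nonneg k hβ hb]

end InjectiveTuples

section FrozenVariables

variable {n k m : ℕ} {F : Fin m → ClauseData n k}

/-- The literal `z` is false under every satisfying assignment of the formula `F`. -/
def Refutes (F : Fin m → ClauseData n k) (z : Literal n) : Prop :=
  ∀ σ, (∀ i, (F i).toClause.Holds σ) → ¬ z.Holds σ

open Classical in
/-- The indicator function of `Refutes F`. -/
noncomputable def refuteInd (F : Fin m → ClauseData n k) (z : Literal n) : ℝ :=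
  if Refutes F z then 1 else 0

/-- For satisfiable `F`, the indicator that the variable `v` is frozen: it takes the same value
under all satisfying assignments. -/
noncomputable def frozenInd (F : Fin m → ClauseData n k) (v : Fin n) : ℝ :=
  refuteInd F (v, 1) + refuteInd F (v, -1)

/-- For satisfiable `F`, the common value of the frozen variable `v`, and `0` if `v` is not
frozen. -/
noncomputable def frozenSign (F : Fin m → ClauseData n k) (v : Fin n) : ℝ :=
  refuteInd F (v, -1) - refuteInd F (v, 1)

/-- For satisfiable `F`, the number of frozen variables. -/
noncomputable def numFrozen (F : Fin m → ClauseData n k) : ℝ := ∑ v, frozenInd F v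

lemma refuteInd_mem_Icc (F : Fin m → ClauseData n k) (z : Literal n) :
    refuteInd F z ∈ Set.Icc 0 1 := by
  unfold refuteInd
  split_ifs <;> simp

lemma abs_frozenSign_le (F : Fin m → ClauseData n k) (v : Fin n) :
    |frozenSign F v| ≤ frozenInd F v := by
  have h₁ := (refuteInd_mem_Icc F (v, 1)).1
  have h₂ := (refuteInd_mem_Icc F (v, -1)).1
  rw [frozenSign, frozenInd, abs_le]
  constructor <;> linarith

lemma frozenInd_le_one (hF : IsSat F) (v : Fin n) : frozenInd F v ≤ 1 := by
  obtain ⟨σ, hσ⟩ := hF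
  have not_refuted : refuteInd F (v, σ v) = 0 := if_neg fun h => h σ hσ rfl
  have h₁ := (refuteInd_mem_Icc F (v, 1)).2
  have h₂ := (refuteInd_mem_Icc F (v, -1)).2
  unfold frozenInd
  obtain hs | hs := Int.units_eq_one_or (σ v) <;> rw [hs] at not_refuted <;> linarith

lemma numFrozen_nonneg (F : Fin m → ClauseData n k) : 0 ≤ numFrozen F :=
  Finset.sum_nonneg fun v _ => (abs_nonneg _).trans (abs_frozenSign_le F v)

lemma numFrozen_le (hF : IsSat F) : numFrozen F ≤ n := by
  simpa [numFrozen] using Finset.sum_le_card_nsmul Finset.univ (frozenInd F) 1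
    fun v _ => frozenInd_le_one hF v

lemma not_isSat_insertNth_iff {d : ClauseData n k} (i : Fin (m + 1)) :
    ¬ IsSat (i.insertNth d F : Fin (m + 1) → ClauseData n k) ↔ ∀ j, Refutes F (d.toClause j) := by
  rw [isSat_insertNth]
  exact ⟨fun h j σ hσ hj => h ⟨σ, ⟨j, hj⟩, hσ⟩, fun h ⟨σ, ⟨j, hj⟩, hσ⟩ => h j σ hσ hj⟩

lemma satInd_insertNth (i : Fin (m + 1)) (d : ClauseData n k) (F : Fin m → ClauseData n k) :
    satInd (i.insertNth d F : Fin (m + 1) → ClauseData n k) =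
      satInd F * (1 - ∏ j, refuteInd F (d.toClause j)) := by
  have prod_eq : ∏ j, refuteInd F (d.toClause j) =
      1 - satInd (i.insertNth d F : Fin (m + 1) → ClauseData n k) := by
    classical
    simp only [refuteInd, Finset.prod_boole, Finset.mem_univ, true_imp_iff,
      ← not_isSat_insertNth_iff i, satInd]
    split_ifs <;> simp
  rw [prod_eq, sub_sub_cancel]
  by_cases hF : IsSat F
  · simp [satInd, hF]
  · have : ¬ IsSat (i.insertNth d F : Fin (m + 1) → ClauseData n k) := fun h =>
      let ⟨σ, _, hσ⟩ := (isSat_insertNth i).1 h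
      hF ⟨σ, hσ⟩
    simp [satInd, hF, this]

lemma expect_prod_refuteInd (b : ℝ) (F : Fin m → ClauseData n k) :
    expect (clauseWeight n k b) (fun d => ∏ j, refuteInd F (d.toClause j)) =
      (2 * (n.descFactorial k : ℝ))⁻¹ * injTupleSum k (frozenInd F) (frozenSign F) b := by
  rw [expect_clauseWeight_prod, injTupleSum]
  congr! 4 with K - <;> refine Finset.prod_congr rfl fun j _ => ?_ <;>
    rw [frozenInd, frozenSign] <;> ring

lemma expect_clauseWeight_satInd_insertNth (hk : k ≤ n) (b : ℝ) (i : Fin (m + 1))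
    (F : Fin m → ClauseData n k) :
    expect (clauseWeight n k b)
        (fun d => satInd (i.insertNth d F : Fin (m + 1) → ClauseData n k)) =
      satInd F * (1 - (2 * (n.descFactorial k : ℝ))⁻¹ *
        injTupleSum k (frozenInd F) (frozenSign F) b) := by
  simp only [satInd_insertNth, expect_const_mul, expect_sub,
    expect_const (sum_clauseWeight hk b), expect_prod_refuteInd]

end FrozenVariables

section Law

variable {n k : ℕ} {b : ℝ}

instance (p : ℝ) : IsFiniteMeasure (signLaw p) := ⟨by simp [signLaw]⟩

instance (n k : ℕ) (p : ℝ) : IsFiniteMeasure (clauseLaw n k p) := by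
  unfold clauseLaw
  infer_instance

instance (n k m : ℕ) (p : ℝ) : IsFiniteMeasure (formulaLaw n k m p) := by
  unfold formulaLaw
  infer_instance

lemma signLaw_real_singleton (hb : |b| ≤ 1 / 2) (s : ℤˣ) :
    (signLaw (1 / 2 - b)).real {s} = 1 / 2 - ((s : ℤ) : ℝ) * b := by
  obtain ⟨h₁, h₂⟩ := abs_le.1 hb
  have neg_prob : (1 : ℝ) - (1 / 2 - b) = 1 / 2 + b := by ring
  rw [measureReal_def, signLaw, neg_prob]
  obtain rfl | rfl := Int.units_eq_one_or s
  · simpa using h₂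
  · have weight_nonneg : 0 ≤ 1 / 2 + b := by linarith
    simpa using weight_nonneg

lemma uniformOn_injective_real_singleton (K : Fin k → Fin n) :
    (uniformOn {K : Fin k → Fin n | Function.Injective K}).real {K} =
      if Function.Injective K then (n.descFactorial k : ℝ)⁻¹ else 0 := by
  have coe_filter : {K : Fin k → Fin n | Function.Injective K} =
      (({K | Function.Injective K} : Finset (Fin k → Fin n)) : Set (Fin k → Fin n)) := by simp
  rw [measureReal_def, coe_filter, ← Finset.coe_singleton, uniformOn_apply_finset, card_injective]
  split_ifs with hK <;> simp [hK]

lemma clauseLaw_real_singleton (hb : |b| ≤ 1 / 2) (d : ClauseData n k) :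
    (clauseLaw n k (1 / 2 - b)).real {d} = clauseWeight n k b d := by
  obtain ⟨K, B, P⟩ := d
  have fair_sign : (signLaw (1 / 2)).real {B} = 1 / 2 := by
    simpa using signLaw_real_singleton (b := 0) (by norm_num) B
  rw [← Set.singleton_prod_singleton, ← Set.singleton_prod_singleton, clauseLaw,
    measureReal_prod_prod, measureReal_prod_prod, fair_sign, uniformOn_injective_real_singleton,
    measureReal_def, Measure.pi_singleton, ENNReal.toReal_prod]
  simp only [← measureReal_def, signLaw_real_singleton hb, clauseWeight]

lemma satProb_eq_satPoly (n k m : ℕ) (hb : |b| ≤ 1 / 2) :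
    satProb n k m b = satPoly n k m b := by
  classical
  have coe_filter : {F : Fin m → ClauseData n k | IsSat F} =
      (({F | IsSat F} : Finset (Fin m → ClauseData n k)) : Set (Fin m → ClauseData n k)) := by
    simp
  change (formulaLaw n k m (1 / 2 - b)).real {F | IsSat F} = _
  rw [coe_filter, ← sum_measureReal_singleton, Finset.sum_filter]
  refine Finset.sum_congr rfl fun F _ => ?_
  rw [formulaLaw, measureReal_def, Measure.pi_singleton, ENNReal.toReal_prod]
  simp only [← measureReal_def, clauseLaw_real_singleton hb, satInd, iidWeight, mul_ite, mul_one,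
    mul_zero]

end Law

section Moments

variable {n k m : ℕ} {b : ℝ}

lemma satInd_mul_le_satInd_mul {F : Fin m → ClauseData n k} {x y : ℝ} (h : IsSat F → x ≤ y) :
    satInd F * x ≤ satInd F * y := by
  by_cases hF : IsSat F
  · exact mul_le_mul_of_nonneg_left (h hF) (satInd_mem_Icc F).1
  · simp [satInd, hF]

lemma satPoly_sub_satPoly_succ (hk : k ≤ n) (m : ℕ) (b : ℝ) :
    satPoly n k m b - satPoly n k (m + 1) b =
      (2 * (n.descFactorial k : ℝ))⁻¹ * expect (iidWeight (clauseWeight n k b))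
        fun F : Fin m → _ => satInd F * injTupleSum k (frozenInd F) (frozenSign F) b := by
  rw [satPoly, satPoly, expect_iidWeight_insertNth _ 0, expect_comm, ← expect_sub,
    ← expect_const_mul]
  refine congrArg _ (funext fun F => ?_)
  rw [expect_clauseWeight_satInd_insertNth hk]
  ring

/-- The `l`-th moment of the number of frozen variables of a random formula with `m` clauses,
restricted to the event that the formula is satisfiable. -/
noncomputable def frozenMoment (n k m : ℕ) (b : ℝ) (l : ℕ) : ℝ :=
  expect (iidWeight (clauseWeight n k b)) fun F : Fin m → _ => satInd F * numFrozen F ^ l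

lemma frozenMoment_le_pow (hk : k ≤ n) (hb : |b| ≤ 1 / 2) (l : ℕ) :
    frozenMoment n k m b l ≤ n ^ l := by
  have hw := iidWeight_mem_stdSimplex (m := m) (clauseWeight_mem_stdSimplex hk hb)
  rw [← expect_const hw.2 ((n : ℝ) ^ l)]
  refine expect_mono hw.1 fun F => ?_
  calc satInd F * numFrozen F ^ l ≤ satInd F * n ^ l :=
        satInd_mul_le_satInd_mul fun hF =>
          pow_le_pow_left₀ (numFrozen_nonneg F) (numFrozen_le hF) l
    _ ≤ n ^ l := mul_le_of_le_one_left (by positivity) (satInd_mem_Icc F).2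

lemma frozenMoment_sub_le (hk : k ≤ n) (hb : |b| ≤ 1 / 2) :
    frozenMoment n k m b k / 2 ^ (k - 1) - 2 * k ^ 2 * frozenMoment n k m b (k - 1) ≤
      2 * n.descFactorial k * (satPoly n k m b - satPoly n k (m + 1) b) := by
  have hw := iidWeight_mem_stdSimplex (m := m) (clauseWeight_mem_stdSimplex hk hb)
  have descFactorial_pos : (0 : ℝ) < n.descFactorial k := by
    exact_mod_cast Nat.descFactorial_pos.2 hk
  rw [satPoly_sub_satPoly_succ hk, mul_inv_cancel_left₀ (by positivity), div_eq_inv_mul,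
    frozenMoment, frozenMoment, ← expect_const_mul, ← expect_const_mul, ← expect_sub]
  refine expect_mono hw.1 fun F => ?_
  calc (2 ^ (k - 1))⁻¹ * (satInd F * numFrozen F ^ k) -
        2 * k ^ 2 * (satInd F * numFrozen F ^ (k - 1))
      = satInd F * (numFrozen F ^ k / 2 ^ (k - 1) - 2 * k ^ 2 * numFrozen F ^ (k - 1)) := by ring
    _ ≤ satInd F * injTupleSum k (frozenInd F) (frozenSign F) b :=
        satInd_mul_le_satInd_mul fun hF =>
          le_injTupleSum (frozenInd_le_one hF) (abs_frozenSign_le F) hb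

/-- The constant in `succ_mul_frozenMoment_le`. -/
noncomputable def momentConst (k : ℕ) (r : ℝ) : ℝ :=
  2 ^ k * (dropConst k r + k ^ 2 * r)

lemma succ_mul_frozenMoment_le {r : ℝ} (hk0 : 0 < k) (hk : k ≤ n) (hb : |b| ≤ 1 / 2)
    (hm : m + 1 ≤ r * n) :
    (m + 1) * frozenMoment n k m b k ≤ momentConst k r * (n ^ k * √n) := by
  have hr : 0 ≤ r := (pos_of_mul_pos_left (hm.trans_lt' (by positivity)) n.cast_nonneg).le
  have sqrt_one_le : 1 ≤ √(n : ℝ) := Real.one_le_sqrt.2 (by exact_mod_cast hk0.trans_le hk)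
  have drop : 2 * (n.descFactorial k : ℝ) *
      ((m + 1) * (satPoly n k m b - satPoly n k (m + 1) b)) ≤
        2 * n ^ k * (dropConst k r * √n) := by
    have dropConst_nonneg : 0 ≤ dropConst k r := by unfold dropConst; positivity
    calc _ ≤ 2 * (n.descFactorial k : ℝ) * (dropConst k r * √n) :=
          mul_le_mul_of_nonneg_left (satPoly_sub_satPoly_succ_le hk0 hk hb hm) (by positivity)
      _ ≤ 2 * n ^ k * (dropConst k r * √n) := by
          gcongr
          exact_mod_cast Nat.descFactorial_le_pow n k
  have collisions : (m + 1) * frozenMoment n k m b (k - 1) ≤ r * (n ^ k * √n) :=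
    calc (m + 1) * frozenMoment n k m b (k - 1) ≤ (m + 1) * n ^ (k - 1) :=
          mul_le_mul_of_nonneg_left (frozenMoment_le_pow hk hb (k - 1)) (by positivity)
      _ ≤ r * n * n ^ (k - 1) := by gcongr
      _ = r * n ^ k := by rw [mul_assoc, mul_pow_sub_one hk0.ne']
      _ ≤ r * (n ^ k * √n) := by
          gcongr
          exact le_mul_of_one_le_right (by positivity) sqrt_one_le
  calc (m + 1) * frozenMoment n k m b k
      = 2 ^ (k - 1) * ((m + 1) * (frozenMoment n k m b k / 2 ^ (k - 1))) := by field_simp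
    _ ≤ 2 ^ (k - 1) * (2 * n ^ k * (dropConst k r * √n) + 2 * k ^ 2 * (r * (n ^ k * √n))) := by
        refine mul_le_mul_of_nonneg_left ?_ (by positivity)
        have := mul_le_mul_of_nonneg_left (frozenMoment_sub_le (m := m) hk hb)
          (by positivity : (0 : ℝ) ≤ m + 1)
        have := mul_le_mul_of_nonneg_left collisions (by positivity : (0 : ℝ) ≤ 2 * k ^ 2)
        linarith
    _ = momentConst k r * (n ^ k * √n) := by
        rw [momentConst, ← mul_pow_sub_one hk0.ne' (2 : ℝ)]
        ring

lemma pow_pred_le_add {x t : ℝ} (hk0 : 0 < k) (hx : 0 ≤ x) (ht : 0 < t) :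
    x ^ (k - 1) ≤ t ^ (k - 1) + x ^ k / t := by
  obtain h | h := le_total x t
  · exact (pow_le_pow_left₀ hx h _).trans (le_add_of_nonneg_right (by positivity))
  · calc x ^ (k - 1) ≤ x ^ k / t := by
          rw [le_div_iff₀ ht, ← pow_sub_one_mul hk0.ne']
          gcongr
      _ ≤ t ^ (k - 1) + x ^ k / t := le_add_of_nonneg_left (by positivity)

lemma frozenMoment_pred_le {t : ℝ} (hk0 : 0 < k) (hk : k ≤ n) (hb : |b| ≤ 1 / 2) (ht : 0 < t) :
    frozenMoment n k m b (k - 1) ≤ t ^ (k - 1) + frozenMoment n k m b k / t := by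
  have hw := iidWeight_mem_stdSimplex (m := m) (clauseWeight_mem_stdSimplex hk hb)
  rw [frozenMoment, frozenMoment, div_eq_inv_mul, ← expect_const_mul,
    ← expect_const hw.2 (t ^ (k - 1)), ← expect_add]
  refine expect_mono hw.1 fun F => ?_
  calc satInd F * numFrozen F ^ (k - 1)
      ≤ satInd F * (t ^ (k - 1) + numFrozen F ^ k / t) :=
        satInd_mul_le_satInd_mul fun _ => pow_pred_le_add hk0 (numFrozen_nonneg F) ht
    _ = satInd F * t ^ (k - 1) + t⁻¹ * (satInd F * numFrozen F ^ k) := by ring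
    _ ≤ t ^ (k - 1) + t⁻¹ * (satInd F * numFrozen F ^ k) := by
        gcongr
        exact mul_le_of_le_one_left (by positivity) (satInd_mem_Icc F).2

/-- The threshold in `frozenMoment_pred_le` is taken to be `n * n ^ (-1 / (2 * k))`, which balances
its two terms. -/
lemma succ_mul_frozenMoment_pred_le {r : ℝ} (hk0 : 0 < k) (hk : k ≤ n) (hb : |b| ≤ 1 / 2)
    (hm : m + 1 ≤ r * n) :
    (m + 1) * frozenMoment n k m b (k - 1) ≤
      (r + momentConst k r) * (n ^ k * (n : ℝ) ^ (-(((k : ℝ) - 1) / (2 * k)))) := by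
  have hn : (0 : ℝ) < n := by exact_mod_cast hk0.trans_le hk
  set t : ℝ := (n : ℝ) ^ (-(1 / (2 * (k : ℝ)))) with ht
  have t_pow : t ^ (k - 1) = (n : ℝ) ^ (-(((k : ℝ) - 1) / (2 * k))) := by
    rw [ht, ← Real.rpow_natCast, ← Real.rpow_mul hn.le, Nat.cast_pred hk0]
    congr 1
    field_simp
  have sqrt_div_t : √n / (n * t) = (n : ℝ) ^ (-(((k : ℝ) - 1) / (2 * k))) := by
    rw [ht, Real.sqrt_eq_rpow, ← div_div, ← Real.rpow_sub_one hn.ne', ← Real.rpow_sub hn]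
    congr 1
    field_simp
    ring
  calc (m + 1) * frozenMoment n k m b (k - 1)
      ≤ (m + 1) * ((n * t) ^ (k - 1) + frozenMoment n k m b k / (n * t)) := by
        gcongr
        exact frozenMoment_pred_le hk0 hk hb (by positivity)
    _ = (m + 1) * (n * t) ^ (k - 1) + (m + 1) * frozenMoment n k m b k / (n * t) := by ring
    _ ≤ r * n * (n * t) ^ (k - 1) + momentConst k r * (n ^ k * √n) / (n * t) := by
        refine add_le_add (by gcongr) (div_le_div_of_nonneg_right ?_ (by positivity))
        exact succ_mul_frozenMoment_le hk0 hk hb hm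
    _ = r * (n * n ^ (k - 1) * t ^ (k - 1)) + momentConst k r * (n ^ k * (√n / (n * t))) := by ring
    _ = _ := by
        rw [mul_pow_sub_one hk0.ne', t_pow, sqrt_div_t]
        ring

end Moments

section Derivative

variable {n k m : ℕ} {b : ℝ}

lemma deriv_expect_satInd_insertNth_le (hk : k ≤ n) (hb : b ∈ Set.Icc 0 (1 / 2)) (i : Fin (m + 1))
    (F : Fin m → ClauseData n k) :
    deriv (fun b => expect (clauseWeight n k b)
        fun d => satInd (i.insertNth d F : Fin (m + 1) → ClauseData n k)) b ≤
      k ^ 3 / n.descFactorial k * (satInd F * numFrozen F ^ (k - 1)) := by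
  simp only [expect_clauseWeight_satInd_insertNth hk, deriv_const_mul_field, deriv_const_sub]
  calc satInd F * -((2 * (n.descFactorial k : ℝ))⁻¹ *
        deriv (injTupleSum k (frozenInd F) (frozenSign F)) b)
      = satInd F * ((2 * (n.descFactorial k : ℝ))⁻¹ *
          -deriv (injTupleSum k (frozenInd F) (frozenSign F)) b) := by ring
    _ ≤ satInd F * ((2 * (n.descFactorial k : ℝ))⁻¹ * (2 * k ^ 3 * numFrozen F ^ (k - 1))) := by
        refine satInd_mul_le_satInd_mul fun hF => ?_
        gcongr
        exact neg_le.1 (le_deriv_injTupleSum (frozenInd_le_one hF) (abs_frozenSign_le F) hb)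
    _ = k ^ 3 / n.descFactorial k * (satInd F * numFrozen F ^ (k - 1)) := by
        rw [mul_inv]
        ring

lemma differentiable_satPoly (n k m : ℕ) : Differentiable ℝ (satPoly n k m) :=
  Differentiable.fun_sum fun F _ =>
    (Differentiable.fun_finsetProd fun i _ => differentiable_clauseWeight (F i)).mul_const _

lemma deriv_satPoly_succ_le (hk : k ≤ n) (hb : b ∈ Set.Icc 0 (1 / 2)) :
    deriv (satPoly n k (m + 1)) b ≤
      k ^ 3 / n.descFactorial k * ((m + 1) * frozenMoment n k m b (k - 1)) := by
  have hw := iidWeight_mem_stdSimplex (m := m)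
    (clauseWeight_mem_stdSimplex hk (abs_le.2 ⟨by linarith [hb.1], hb.2⟩))
  have hasDeriv : HasDerivAt (satPoly n k (m + 1)) _ b :=
    hasDerivAt_expect_iidWeight (fun d => differentiable_clauseWeight d b) satInd
  calc deriv (satPoly n k (m + 1)) b
      ≤ ∑ _i : Fin (m + 1), expect (iidWeight (clauseWeight n k b)) fun F : Fin m → _ =>
          k ^ 3 / n.descFactorial k * (satInd F * numFrozen F ^ (k - 1)) := by
        rw [hasDeriv.deriv]
        exact Finset.sum_le_sum fun i _ =>
          expect_mono hw.1 (deriv_expect_satInd_insertNth_le hk hb i)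
    _ = k ^ 3 / n.descFactorial k * ((m + 1) * frozenMoment n k m b (k - 1)) := by
        rw [Finset.sum_const, Finset.card_fin, nsmul_eq_mul, expect_const_mul, frozenMoment]
        push_cast
        ring

lemma pow_le_pow_mul_descFactorial (hk : k ≤ n) : n ^ k ≤ k ^ k * n.descFactorial k := by
  obtain rfl | hk0 := Nat.eq_zero_or_pos k
  · simp
  · calc n ^ k ≤ (k * (n + 1 - k)) ^ k := by
          gcongr
          obtain ⟨l, rfl⟩ := Nat.exists_eq_add_of_le hk
          rw [show k + l + 1 - k = l + 1 by omega]
          nlinarith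
      _ = k ^ k * (n + 1 - k) ^ k := mul_pow ..
      _ ≤ k ^ k * n.descFactorial k := by
          gcongr
          exact Nat.pow_sub_le_descFactorial n k

/-- The constant in `deriv_satPoly_le`. -/
noncomputable def derivConst (k : ℕ) (r : ℝ) : ℝ :=
  k ^ (k + 3) * (r + momentConst k r)

lemma deriv_satPoly_le {r : ℝ} (hk0 : 0 < k) (hk : k ≤ n) (hm : m ≤ r * n)
    (hb : b ∈ Set.Icc 0 (1 / 2)) :
    deriv (satPoly n k m) b ≤
      derivConst k r * (n : ℝ) ^ (-(((k : ℝ) - 1) / (2 * k))) := by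
  have hr : 0 ≤ r := nonneg_of_mul_nonneg_left (hm.trans' m.cast_nonneg)
    (by exact_mod_cast hk0.trans_le hk)
  have momentConst_nonneg : 0 ≤ momentConst k r := by unfold momentConst dropConst; positivity
  set ε : ℝ := (n : ℝ) ^ (-(((k : ℝ) - 1) / (2 * k)))
  obtain _ | m := m
  · have satPoly_zero : satPoly n k 0 = fun _ => satInd (n := n) (k := k) finZeroElim :=
      funext fun b => expect_iidWeight_zero (clauseWeight n k b) satInd _
    rw [satPoly_zero, deriv_const, derivConst]
    positivity
  · have descFactorial_pos : (0 : ℝ) < n.descFactorial k := by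
      exact_mod_cast Nat.descFactorial_pos.2 hk
    calc deriv (satPoly n k (m + 1)) b
        ≤ k ^ 3 / n.descFactorial k * ((m + 1) * frozenMoment n k m b (k - 1)) :=
          deriv_satPoly_succ_le hk hb
      _ ≤ k ^ 3 / n.descFactorial k * ((r + momentConst k r) * (n ^ k * ε)) := by
          refine mul_le_mul_of_nonneg_left ?_ (by positivity)
          exact succ_mul_frozenMoment_pred_le hk0 hk (abs_le.2 ⟨by linarith [hb.1], hb.2⟩)
            (by exact_mod_cast hm)
      _ ≤ k ^ 3 / n.descFactorial k *
            ((r + momentConst k r) * (k ^ k * n.descFactorial k * ε)) := by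
          gcongr
          exact_mod_cast pow_le_pow_mul_descFactorial hk
      _ = derivConst k r * ε := by
          rw [derivConst, pow_add]
          field_simp

end Derivative

end PolarizedSAT

theorem mainTheorem3_general (k : ℕ) (hk : 0 < k) (r : ℝ) :
    ∃ c : ℝ, ∀ n m : ℕ, k ≤ n → (m : ℝ) / (n : ℝ) ≤ r →
      ∀ b ∈ Set.Icc (0 : ℝ) (1 / 2),
        DifferentiableWithinAt ℝ (PolarizedSAT.satProb n k m) (Set.Icc (-(1 / 2) : ℝ) (1 / 2)) b ∧
          derivWithin (PolarizedSAT.satProb n k m) (Set.Icc (-(1 / 2) : ℝ) (1 / 2)) b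
            ≤ c * (n : ℝ) ^ (-(((k : ℝ) - 1) / (2 * (k : ℝ)))) := by
  refine ⟨PolarizedSAT.derivConst k r, fun n m hkn hm b hb => ?_⟩
  have hn : (0 : ℝ) < n := by exact_mod_cast hk.trans_le hkn
  have hb' : b ∈ Set.Icc (-(1 / 2) : ℝ) (1 / 2) := ⟨by linarith [hb.1], hb.2⟩
  have hasDeriv : HasDerivWithinAt (PolarizedSAT.satProb n k m)
      (deriv (PolarizedSAT.satPoly n k m) b) (Set.Icc (-(1 / 2)) (1 / 2)) b :=
    (PolarizedSAT.differentiable_satPoly n k m b).hasDerivAt.hasDerivWithinAt.congr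
      (fun x hx => PolarizedSAT.satProb_eq_satPoly n k m (abs_le.2 hx))
      (PolarizedSAT.satProb_eq_satPoly n k m (abs_le.2 hb'))
  refine ⟨hasDeriv.differentiableWithinAt, ?_⟩
  rw [hasDeriv.derivWithin (uniqueDiffOn_Icc (by norm_num) b hb')]
  exact PolarizedSAT.deriv_satPoly_le hk hkn ((div_le_iff₀ hn).1 hm) hb

theorem mainTheorem3 (k : ℕ) (hk : 2 ≤ k) :
    ∃ c : ℝ, (k : ℝ) ≤ c ∧
      ∀ n m : ℕ, c < (n : ℝ) → (m : ℝ) / (n : ℝ) ∈ Set.Icc (1 / 2 : ℝ) (2 ^ k) →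
        ∀ b ∈ Set.Icc (0 : ℝ) (1 / 2),
          DifferentiableWithinAt ℝ (PolarizedSAT.satProb n k m)
              (Set.Icc (-(1 / 2) : ℝ) (1 / 2)) b ∧
            derivWithin (PolarizedSAT.satProb n k m) (Set.Icc (-(1 / 2) : ℝ) (1 / 2)) b
              ≤ c * (n : ℝ) ^ (-(((k : ℝ) - 1) / (2 * (k : ℝ)))) := by
  obtain ⟨c, hc⟩ := mainTheorem3_general k (by lia) (2 ^ k)
  refine ⟨max c k, le_max_right c k, fun n m hn hm b hb => ?_⟩
  have hkn : k ≤ n := by exact_mod_cast (le_max_right c k).trans hn.le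
  obtain ⟨differentiable, deriv_le⟩ := hc n m hkn hm.2 b hb
  exact ⟨differentiable, deriv_le.trans (by gcongr; exact le_max_left c k)⟩
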